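/- Let $n,k,t$ be positive integers. A $k$-partition of $[n]=\{1,\dots,n\}$ is a set of $k$ pairwise disjoint non-empty subsets of $[n]$ (its blocks) whose union is $[n]$. A family of $k$-partitions of $[n]$ is $t$-intersecting if any two of its members have at least $t$ blocks in common, and a $t$-intersecting family of $k$-partitions of $[n]$ is maximal if it is not properly contained in another $t$-intersecting family of $k$-partitions of $[n]$. Let $S(m,r)$ denote the Stirling number of the second kind, i.e. the number of partitions of an $m$-set into $r$ non-empty blocks, and put $$L(k,t)=(t+1)+(k-t+1)\log_2\bigl((t+1)(k-t+1)\bigr).$$ Suppose that $k\ge t+3$ and $n\ge 2L(k,t)$, and let $\mathcal F$ be a maximal $t$-intersecting family of $k$-partitions of $[n]$ with $|\mathcal F|<S(n-t,k-t)$. Then $|\mathcal F|\le S(n-t-1,k-t)$. Moreover, equality holds only if there are a set $A\subseteq[n]$ with $|A|=t-1$ and a set $B\subseteq[n]\setminus A$ with $|B|=2$ such that $\mathcal F$ consists of all $k$-partitions of $[n]$ that have $B$ and all the singletons $\{a\}$, $a\in A$, among their blocks. -/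

import Mathlib

namespace PartitionFamilies

/-- A partition of the standard `n`-set (modelled by `Fin n`) into pairwise disjoint non-empty
blocks whose union is everything. -/
abbrev SetPartition (n : ℕ) : Type := Finpartition (Finset.univ : Finset (Fin n))

/-- The collection of all `k`-partitions of the `n`-set: the partitions with exactly `k` blocks. -/
def kPartitions (n k : ℕ) : Finset (SetPartition n) :=
  Finset.univ.filter fun P => P.parts.card = k

/-- A family of partitions is `t`-intersecting if any two of its members have at least `t` blocks
in common. -/
def IsIntersectingFamily {n : ℕ} (t : ℕ) (F : Finset (SetPartition n)) : Prop :=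
  ∀ P ∈ F, ∀ Q ∈ F, t ≤ (P.parts ∩ Q.parts).card

/-- `F` is a maximal `t`-intersecting family of `k`-partitions: it is a `t`-intersecting family of
`k`-partitions and equals every such family that contains it. -/
def IsMaximalIntersectingFamily {n : ℕ} (k t : ℕ) (F : Finset (SetPartition n)) : Prop :=
  Maximal (fun G : Finset (SetPartition n) => G ⊆ kPartitions n k ∧ IsIntersectingFamily t G) F

/-- `L(k,t) = (t+1) + (k-t+1) * log₂((t+1)(k-t+1))`, with real subtraction. -/
noncomputable def L (k t : ℕ) : ℝ :=
  ((t : ℝ) + 1) + ((k : ℝ) - t + 1) * Real.logb 2 (((t : ℝ) + 1) * ((k : ℝ) - t + 1))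

end PartitionFamilies

/-!
A `t`-cover of a `t`-intersecting family `F` is a set of blocks that shares at least `t` blocks with
every member of `F`. If some `t` blocks form a cover, then they lie in every member of `F`, so by
maximality `F` consists of all `k`-partitions containing them. Covering `c` points, they leave
`S(n - c, k - t)` possibilities: here `c = t` is excluded by the hypothesis on `|F|`, and
`c = t + 1` forces the `t` blocks to be one pair and `t - 1` singletons.

Otherwise let `τ > t` be the least size of a cover. Every member of `F` contains `t` of the `τ`
blocks of a minimal cover. As long as a set `X` of blocks is not a cover, some member `Q` of `F`
shares fewer than `t` blocks with `X`; every member of `F` containing `X` shares at least `t` with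
`Q`, hence at least one from any `k - t + 1` blocks of `Q` outside `X`. So `X` can be enlarged in
`k - t + 1` ways such that each member of `F` containing `X` also contains an enlargement.
Hence `F` has at most `(τ choose t) (k - t + 1) ^ (τ - t) S(n - τ, k - τ)` members (for `τ = k` one
stops at `k - 1` blocks instead). The lower bound on `n` makes `S(m, r + 1) / S(m, r)` so large that
this is less than `S(n - t - 1, k - t)`.
-/

namespace PartitionFamilies

section StirlingNumbers

open Finset Nat

theorem sum_descFactorial_mul_stirlingSecond (N m : ℕ) :
    ∑ j ∈ range (N + 1), N.descFactorial j * stirlingSecond m j = N ^ m := by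
  induction m with
  | zero =>
    rw [sum_range_succ']
    simp
  | succ m ih =>
    have recurrence : ∑ j ∈ range (N + 1), N.descFactorial j * stirlingSecond (m + 1) j =
        ∑ j ∈ range (N + 1), N.descFactorial j * (j * stirlingSecond m j) +
          ∑ j ∈ range (N + 1), N.descFactorial (j + 1) * stirlingSecond m j := by
      rw [sum_range_succ', sum_range_succ' (fun j => N.descFactorial j * (j * stirlingSecond m j)),
        sum_range_succ (fun j => N.descFactorial (j + 1) * stirlingSecond m j)]
      simp [stirlingSecond_succ_succ, mul_add, sum_add_distrib]
    rw [recurrence, ← sum_add_distrib, pow_succ', ← ih, mul_sum]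
    refine sum_congr rfl fun j hj => ?_
    obtain ⟨d, rfl⟩ := Nat.exists_eq_add_of_le (mem_range_succ_iff.1 hj)
    rw [descFactorial_succ, Nat.add_sub_cancel_left]
    ring

theorem factorial_mul_stirlingSecond_le_pow (m r : ℕ) : r ! * stirlingSecond m r ≤ r ^ m := by
  rw [← sum_descFactorial_mul_stirlingSecond r m, ← descFactorial_self]
  exact single_le_sum (f := fun j => r.descFactorial j * stirlingSecond m j)
    (fun _ _ => Nat.zero_le _) (self_mem_range_succ r)

theorem succ_pow_le_factorial_mul_stirlingSecond_add (m r : ℕ) :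
    (r + 1) ^ m ≤ (r + 1)! * stirlingSecond m (r + 1) + (r + 1) * r ^ m := by
  rw [← sum_descFactorial_mul_stirlingSecond (r + 1) m, sum_range_succ, descFactorial_self,
    add_comm, ← sum_descFactorial_mul_stirlingSecond r m, mul_sum]
  refine Nat.add_le_add_left (sum_le_sum fun j hj => ?_) _
  have hj : 0 < r + 1 - j := Nat.sub_pos_of_lt (mem_range.1 hj)
  calc (r + 1).descFactorial j * stirlingSecond m j
      ≤ (r + 1 - j) * (r + 1).descFactorial j * stirlingSecond m j := by
        gcongr
        exact Nat.le_mul_of_pos_left _ hj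
    _ = (r + 1) * (r.descFactorial j * stirlingSecond m j) := by
        rw [succ_descFactorial, mul_assoc]

theorem mul_stirlingSecond_le_of_mul_pow_le {m r w : ℕ} (h : w * r ^ m ≤ (r + 1) ^ m) :
    w * stirlingSecond m r ≤ (r + 1) * (stirlingSecond m (r + 1) + stirlingSecond m r) := by
  rcases le_total w (r + 1) with hw | hw
  · exact Nat.mul_le_mul hw (Nat.le_add_left _ _)
  obtain ⟨d, rfl⟩ := Nat.exists_eq_add_of_le hw
  have hd : d * r ^ m ≤ (r + 1)! * stirlingSecond m (r + 1) := by
    linarith [succ_pow_le_factorial_mul_stirlingSecond_add m r]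
  have key : d * stirlingSecond m r ≤ (r + 1) * stirlingSecond m (r + 1) := by
    refine Nat.le_of_mul_le_mul_left ?_ (factorial_pos r)
    calc r ! * (d * stirlingSecond m r) = d * (r ! * stirlingSecond m r) := by ring
      _ ≤ d * r ^ m := by gcongr; exact factorial_mul_stirlingSecond_le_pow m r
      _ ≤ (r + 1)! * stirlingSecond m (r + 1) := hd
      _ = r ! * ((r + 1) * stirlingSecond m (r + 1)) := by rw [factorial_succ]; ring
  linarith

theorem two_mul_pow_self_le_succ_pow {r : ℕ} (hr : r ≠ 0) : 2 * r ^ r ≤ (r + 1) ^ r := by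
  have bernoulli := pow_add_mul_le_add_pow_of_sq_nonneg (a := r) (b := 1)
    (Nat.zero_le _) (Nat.zero_le _) (Nat.zero_le _) (Nat.zero_le _) r
  rwa [Nat.cast_id, mul_one, mul_pow_sub_one hr, ← two_mul] at bernoulli

theorem mul_pow_le_succ_pow_of_pow_le_two_pow {m r w : ℕ} (hr : r ≠ 0) (h : w ^ r ≤ 2 ^ m) :
    w * r ^ m ≤ (r + 1) ^ m := by
  refine (Nat.pow_le_pow_iff_left hr).1 ?_
  calc (w * r ^ m) ^ r = w ^ r * (r ^ r) ^ m := by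
        rw [mul_pow, ← pow_mul, ← pow_mul, mul_comm m r]
    _ ≤ 2 ^ m * (r ^ r) ^ m := by gcongr
    _ = (2 * r ^ r) ^ m := by rw [mul_pow]
    _ ≤ ((r + 1) ^ r) ^ m := by gcongr; exact two_mul_pow_self_le_succ_pow hr
    _ = ((r + 1) ^ m) ^ r := by rw [← pow_mul, ← pow_mul, mul_comm]

theorem sq_mul_stirlingSecond_le {m r x : ℕ} (hr : r ≠ 0) (h : x ^ (2 * r) ≤ 2 ^ m) :
    x ^ 2 * stirlingSecond m r ≤ (r + 1) * (stirlingSecond m (r + 1) + stirlingSecond m r) :=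
  mul_stirlingSecond_le_of_mul_pow_le
    (mul_pow_le_succ_pow_of_pow_le_two_pow hr (by rwa [← pow_mul]))

theorem mul_stirlingSecond_le_succ_succ {m r x : ℕ} (hr : r ≠ 0) (hx : r < x)
    (h : x ^ (2 * r) ≤ 2 ^ m) : x * stirlingSecond m r ≤ stirlingSecond (m + 1) (r + 1) := by
  have hsq : (x + r) * stirlingSecond m r ≤ x ^ 2 * stirlingSecond m r := by
    gcongr
    nlinarith
  rw [stirlingSecond_succ_succ]
  linarith [sq_mul_stirlingSecond_le hr h]

theorem pow_mul_stirlingSecond_le_add_add {m r x j : ℕ} (hr : r ≠ 0) (hx : r + j < x)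
    (h : x ^ (2 * (r + j)) ≤ 2 ^ (m + j)) :
    x ^ j * stirlingSecond m r ≤ stirlingSecond (m + j) (r + j) := by
  induction j with
  | zero => simp
  | succ j ih =>
    have hj : x ^ (2 * (r + j)) ≤ 2 ^ (m + j) := by
      refine Nat.le_of_mul_le_mul_right ?_ two_pos
      calc x ^ (2 * (r + j)) * 2 ≤ x ^ (2 * (r + j)) * x ^ 2 := by gcongr; nlinarith
        _ = x ^ (2 * (r + (j + 1))) := by ring
        _ ≤ 2 ^ (m + (j + 1)) := h
        _ = 2 ^ (m + j) * 2 := by ring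
    calc x ^ (j + 1) * stirlingSecond m r = x * (x ^ j * stirlingSecond m r) := by ring
      _ ≤ x * stirlingSecond (m + j) (r + j) := by gcongr; exact ih (by lia) hj
      _ ≤ stirlingSecond (m + (j + 1)) (r + (j + 1)) :=
        mul_stirlingSecond_le_succ_succ (by lia) (by lia) hj

theorem stirlingSecond_pos {m r : ℕ} (hr : r ≠ 0) (h : r ≤ m) : 0 < stirlingSecond m r := by
  induction m, h using Nat.le_induction with
  | base => simp [stirlingSecond_self]
  | succ m _ ih =>
    rw [stirlingSecond_succ_left _ _ hr]
    positivity

theorem stirlingSecond_mono {r : ℕ} (hr : r ≠ 0) : Monotone fun m => stirlingSecond m r :=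
  monotone_nat_of_le_succ fun m => by
    rw [stirlingSecond_succ_left _ _ hr]
    exact le_add_right (Nat.le_mul_of_pos_left _ (Nat.pos_of_ne_zero hr))

theorem stirlingSecond_lt_stirlingSecond {a b r : ℕ} (hr : 2 ≤ r) (hab : a < b) (hrb : r ≤ b) :
    stirlingSecond a r < stirlingSecond b r := by
  obtain ⟨b, rfl⟩ := Nat.exists_eq_succ_of_ne_zero (Nat.ne_zero_of_lt hab)
  have hpos : 0 < stirlingSecond b (r - 1) := stirlingSecond_pos (by lia) (by lia)
  calc stirlingSecond a r ≤ stirlingSecond b r := stirlingSecond_mono (by lia) (by lia)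
    _ ≤ r * stirlingSecond b r := Nat.le_mul_of_pos_left _ (by lia)
    _ < r * stirlingSecond b r + stirlingSecond b (r - 1) := Nat.lt_add_of_pos_right hpos
    _ = stirlingSecond (b + 1) r := (stirlingSecond_succ_left _ _ (by lia)).symm

theorem two_mul_le_of_pow_le_two_pow {m r x : ℕ} (hx : 2 ≤ x) (h : x ^ (2 * r) ≤ 2 ^ m) :
    2 * r ≤ m :=
  (Nat.pow_le_pow_iff_right one_lt_two).1 ((Nat.pow_le_pow_left hx _).trans h)

theorem sq_mul_stirlingSecond_lt_succ_right {m r c : ℕ} (hr : r ≠ 0) (hc : c ≠ 0)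
    (h : (c * (r + 2)) ^ (2 * r) ≤ 2 ^ m) :
    c ^ 2 * (r + 2) * stirlingSecond m r < stirlingSecond m (r + 1) := by
  have hc' : 1 ≤ c := Nat.one_le_iff_ne_zero.2 hc
  have hrm : 2 * r ≤ m := two_mul_le_of_pow_le_two_pow (by nlinarith) h
  have hpos : 0 < stirlingSecond m r := stirlingSecond_pos hr (by lia)
  have hcoeff : (r + 1) * (c ^ 2 * (r + 2) + 1) < (c * (r + 2)) ^ 2 := by
    have : 1 * (r + 2) ≤ c ^ 2 * (r + 2) := Nat.mul_le_mul_right _ (Nat.one_le_pow _ _ hc')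
    linarith
  refine Nat.lt_of_mul_lt_mul_left (a := r + 1) ?_
  have hlt := Nat.mul_lt_mul_of_pos_right hcoeff hpos
  linarith [sq_mul_stirlingSecond_le hr h]

theorem sum_powerset_stirlingSecond_card {α : Type*} (s : Finset α) (k : ℕ) :
    ∑ c ∈ s.powerset, stirlingSecond #c k = stirlingSecond (#s + 1) (k + 1) := by
  classical
  induction s using Finset.induction_on generalizing k with
  | empty => cases k <;> simp [stirlingSecond]
  | insert a s ha ih =>
    have hcard : ∀ c ∈ s.powerset, stirlingSecond #(insert a c) k = stirlingSecond (#c + 1) k :=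
      fun c hc => by rw [card_insert_of_notMem fun hac => ha (mem_powerset.1 hc hac)]
    rw [sum_powerset_insert ha, ih, card_insert_of_notMem ha, stirlingSecond_succ_succ (#s + 1) k,
      sum_congr rfl hcard]
    cases k with
    | zero => simp
    | succ k =>
      simp only [stirlingSecond_succ_succ _ k, sum_add_distrib, ← mul_sum, ih]
      ring

end StirlingNumbers

section Covers

open Finset

variable {ι β : Type*} [DecidableEq β] {t k : ℕ} {F : Finset ι} {S : ι → Finset β}

/-- `T` is a `t`-cover of the family `(S i)_{i ∈ F}`: it meets every member in at least `t`
elements. The family is `t`-intersecting if and only if each of its members is a `t`-cover. The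
family is indexed so that the notion applies to partitions, with `S` taking a partition to its set
of blocks. -/
def IsCover (t : ℕ) (F : Finset ι) (S : ι → Finset β) (T : Finset β) : Prop :=
  ∀ i ∈ F, t ≤ #(T ∩ S i)

theorem IsCover.subset_and_card_eq_of_card_le {T : Finset β} (hT : IsCover t F S T) (hcard : #T ≤ t)
    {i : ι} (hi : i ∈ F) : T ⊆ S i ∧ #T = t := by
  have hle : #(T ∩ S i) ≤ #T := card_le_card inter_subset_left
  have hcover := hT i hi
  exact ⟨inter_eq_left.1 (eq_of_subset_of_card_le inter_subset_left (by lia)), by lia⟩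

theorem IsCover.exists_subset_sdiff_card_eq_inter_nonempty {A X : Finset β} (hA : IsCover t F S A)
    (hX : #(X ∩ A) < t) :
    ∃ Z ⊆ A \ X, #Z = #A + 1 - t ∧ ∀ i ∈ F, (Z ∩ S i).Nonempty := by
  have hsplit : #(A \ X) + #(X ∩ A) = #A := by rw [inter_comm, card_sdiff_add_card_inter]
  obtain ⟨Z, hZ, hZcard⟩ := exists_subset_card_eq (s := A \ X) (n := #A + 1 - t) (by lia)
  refine ⟨Z, hZ, hZcard, fun i hi => ?_⟩
  have hcover := hA i hi
  have hmeet : (Z ∩ (A ∩ S i)).Nonempty :=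
    inter_nonempty_of_card_lt_card_add_card (hZ.trans sdiff_subset) inter_subset_left (by lia)
  exact hmeet.mono (inter_subset_inter_left inter_subset_right)

theorem card_filter_subset_le_pow_mul (hS : ∀ i ∈ F, #(S i) ≤ k) (hF : ∀ i ∈ F, IsCover t F S (S i))
    {σ c : ℕ} (hσ : ∀ T, IsCover t F S T → σ ≤ #T)
    (hc : ∀ X : Finset β, #X = σ → #{i ∈ F | X ⊆ S i} ≤ c) (j : ℕ) (X : Finset β)
    (hX : #X + j = σ) : #{i ∈ F | X ⊆ S i} ≤ (k + 1 - t) ^ j * c := by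
  classical
  induction j generalizing X with
  | zero => simpa using hc X hX
  | succ j ih =>
    obtain ⟨q, hq, hqX⟩ : ∃ q ∈ F, #(X ∩ S q) < t := by
      by_contra! hcover
      have := hσ X hcover
      lia
    obtain ⟨Z, hZ, hZcard, hmeet⟩ := (hF q hq).exists_subset_sdiff_card_eq_inter_nonempty hqX
    have hextend : {i ∈ F | X ⊆ S i} ⊆ Z.biUnion fun z => {i ∈ F | insert z X ⊆ S i} := by
      intro i hi
      obtain ⟨hiF, hXi⟩ := mem_filter.1 hi
      obtain ⟨z, hz⟩ := hmeet i hiF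
      obtain ⟨hzZ, hzi⟩ := mem_inter.1 hz
      exact mem_biUnion.2 ⟨z, hzZ, mem_filter.2 ⟨hiF, insert_subset hzi hXi⟩⟩
    calc #{i ∈ F | X ⊆ S i} ≤ #(Z.biUnion fun z => {i ∈ F | insert z X ⊆ S i}) :=
          card_le_card hextend
      _ ≤ #Z * ((k + 1 - t) ^ j * c) := card_biUnion_le_card_mul _ _ _ fun z hz =>
          ih _ (by rw [card_insert_of_notMem (mem_sdiff.1 (hZ hz)).2]; lia)
      _ ≤ (k + 1 - t) * ((k + 1 - t) ^ j * c) := by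
          gcongr
          have := hS q hq
          lia
      _ = (k + 1 - t) ^ (j + 1) * c := by ring

theorem card_le_choose_mul_pow_mul (hS : ∀ i ∈ F, #(S i) ≤ k) (hF : ∀ i ∈ F, IsCover t F S (S i))
    {σ c : ℕ} (htσ : t ≤ σ) (hσ : ∀ T, IsCover t F S T → σ ≤ #T)
    (hc : ∀ X : Finset β, #X = σ → #{i ∈ F | X ⊆ S i} ≤ c) {T : Finset β}
    (hT : IsCover t F S T) : #F ≤ (#T).choose t * ((k + 1 - t) ^ (σ - t) * c) := by
  classical
  have hunion : F ⊆ (T.powersetCard t).biUnion fun X => {i ∈ F | X ⊆ S i} := by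
    intro i hi
    obtain ⟨X, hX, hXcard⟩ := exists_subset_card_eq (hT i hi)
    exact mem_biUnion.2 ⟨X, mem_powersetCard.2 ⟨hX.trans inter_subset_left, hXcard⟩,
      mem_filter.2 ⟨hi, hX.trans inter_subset_right⟩⟩
  rw [← card_powersetCard]
  refine (card_le_card hunion).trans (card_biUnion_le_card_mul _ _ _ fun X hX => ?_)
  have hXcard : #X = t := (mem_powersetCard.1 hX).2
  exact card_filter_subset_le_pow_mul hS hF hσ hc _ _ (by lia)

theorem exists_card_le_pow_mul (hS : ∀ i ∈ F, #(S i) ≤ k) (hF : ∀ i ∈ F, IsCover t F S (S i))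
    (htk : t + 1 < k) {c : ℕ → ℕ}
    (hc : ∀ X : Finset β, #X < k → #{i ∈ F | X ⊆ S i} ≤ c #X)
    (hcover : ∀ T, IsCover t F S T → t < #T) :
    ∃ s, t < s ∧ s < k ∧ #F ≤ (t + 1) ^ (s + 1 - t) * ((k + 1 - t) ^ (s - t) * c s) := by
  obtain ⟨i, hi⟩ : F.Nonempty := by
    by_contra! h
    simpa using hcover ∅ (by simp [IsCover, h])
  obtain ⟨T, hT, hTmin⟩ := exists_minimalFor_of_wellFoundedLT (IsCover t F S) card ⟨S i, hF i hi⟩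
  have hmin : ∀ T', IsCover t F S T' → #T ≤ #T' := fun T' hT' =>
    (le_total #T' #T).elim (hTmin hT') id
  have htT : t < #T := hcover T hT
  have hTk : #T ≤ k := (hmin _ (hF i hi)).trans (hS i hi)
  obtain ⟨s, hts, hsk, hsT, hTs⟩ : ∃ s, t < s ∧ s < k ∧ s ≤ #T ∧ #T ≤ s + 1 :=
    ⟨min #T (k - 1), by lia, by lia, by lia, by lia⟩
  have hbound : #F ≤ (#T).choose t * ((k + 1 - t) ^ (s - t) * c s) :=
    card_le_choose_mul_pow_mul hS hF hts.le (fun T' hT' => hsT.trans (hmin T' hT'))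
      (fun X hX => hX ▸ hc X (hX ▸ hsk)) hT
  have hchoose : (#T).choose t ≤ (t + 1) ^ (s + 1 - t) := by
    calc (#T).choose t ≤ (s + 1).choose t := Nat.choose_le_choose t hTs
      _ = (t + (s + 1 - t)).choose (s + 1 - t) := by
        rw [← Nat.choose_symm_add, Nat.add_sub_of_le (by lia)]
      _ ≤ (t + 1) ^ (s + 1 - t) := Nat.choose_add_le_add_one_pow _ _
  exact ⟨s, hts, hsk, hbound.trans (Nat.mul_le_mul_right _ hchoose)⟩

end Covers

section CountingPartitions

open Finset

variable {α : Type*} [DecidableEq α] {u s : Finset α} {k : ℕ}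

/-- The partition of `u` consisting of the blocks of a partition of `s ⊆ u` and those of a partition
of `u \ s`. -/
@[simps parts]
def glue (hs : s ⊆ u) (P : Finpartition s) (R : Finpartition (u \ s)) : Finpartition u where
  parts := P.parts ∪ R.parts
  supIndep := by
    rw [supIndep_iff_pairwiseDisjoint, coe_union, Set.pairwiseDisjoint_union]
    exact ⟨P.disjoint, R.disjoint, fun b hb c hc _ => disjoint_sdiff.mono (P.le hb) (R.le hc)⟩
  sup_parts := by
    rw [sup_union, P.sup_parts, R.sup_parts]
    exact union_sdiff_of_subset hs
  bot_notMem h := (mem_union.1 h).elim P.bot_notMem R.bot_notMem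

theorem disjoint_parts_of_disjoint {v : Finset α} (h : Disjoint s v) (P : Finpartition s)
    (R : Finpartition v) : Disjoint P.parts R.parts :=
  Finset.disjoint_left.2 fun _ hP hR => P.ne_bot hP (le_bot_iff.1 (h (P.le hP) (R.le hR)))

theorem sup_parts_sdiff (Q : Finpartition u) {Y : Finset (Finset α)} (hY : Y ⊆ Q.parts) :
    (Q.parts \ Y).sup id = u \ Y.sup id := by
  have hdisj : Disjoint (Y.sup id) ((Q.parts \ Y).sup id) :=
    Q.supIndep.disjoint_sup_sup hY sdiff_subset disjoint_sdiff
  have hunion : Y.sup id ∪ (Q.parts \ Y).sup id = u := by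
    rw [← sup_eq_union, ← sup_union, union_sdiff_of_subset hY, Q.sup_parts]
  calc (Q.parts \ Y).sup id = (Y.sup id ∪ (Q.parts \ Y).sup id) \ Y.sup id :=
        (union_sdiff_cancel_left hdisj).symm
    _ = u \ Y.sup id := by rw [hunion]

/-- The partition of the remaining points left by removing from a partition some of its blocks. -/
@[simps! parts]
def removeBlocks (Q : Finpartition u) {Y : Finset (Finset α)} (hY : Y ⊆ Q.parts) :
    Finpartition (u \ Y.sup id) :=
  Q.ofSubset sdiff_subset (sup_parts_sdiff Q hY)

/-- The partitions of the finite set `u` into exactly `k` blocks, so that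
`kPartitions n k = kBlockPartitions univ k`. -/
def kBlockPartitions (u : Finset α) (k : ℕ) : Finset (Finpartition u) :=
  {P | #P.parts = k}

theorem mem_kBlockPartitions {P : Finpartition u} : P ∈ kBlockPartitions u k ↔ #P.parts = k := by
  simp [kBlockPartitions]

theorem card_filter_subset_parts_eq_card_kBlockPartitions {Q : Finpartition u}
    {Y : Finset (Finset α)} (hY : Y ⊆ Q.parts) (hk : #Y ≤ k) :
    #{P ∈ kBlockPartitions u k | Y ⊆ P.parts} = #(kBlockPartitions (u \ Y.sup id) (k - #Y)) := by
  have hsup : Y.sup id ⊆ u := Finset.sup_le fun b hb => Q.le (hY hb)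
  have hdisj (R : Finpartition (u \ Y.sup id)) : Disjoint Y R.parts :=
    disjoint_parts_of_disjoint disjoint_sdiff (Q.ofSubset hY rfl) R
  refine card_bij' (fun P hP => removeBlocks P (mem_filter.1 hP).2)
    (fun R _ => glue hsup (Q.ofSubset hY rfl) R) ?_ ?_ ?_ ?_
  · intro P hP
    obtain ⟨hPk, hYP⟩ := mem_filter.1 hP
    rw [mem_kBlockPartitions] at hPk ⊢
    rw [removeBlocks_parts, card_sdiff_of_subset hYP, hPk]
  · intro R hR
    rw [mem_kBlockPartitions] at hR
    refine mem_filter.2 ⟨mem_kBlockPartitions.2 ?_, subset_union_left⟩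
    rw [glue_parts, Finpartition.ofSubset_parts, card_union_of_disjoint (hdisj R)]
    lia
  · intro P hP
    ext1
    exact union_sdiff_of_subset (mem_filter.1 hP).2
  · intro R _
    ext1
    exact union_sdiff_cancel_left (hdisj R)

theorem card_filter_part_eq {a : α} {b : Finset α} (hb : b ⊆ u) (hab : a ∈ b) :
    #{P ∈ kBlockPartitions u (k + 1) | P.part a = b} = #(kBlockPartitions (u \ b) k) := by
  have hpart (P : Finpartition u) : P.part a = b ↔ {b} ⊆ P.parts := by
    rw [singleton_subset_iff]
    exact ⟨fun h => h ▸ P.part_mem.2 (hb hab), fun h => P.part_eq_of_mem h hab⟩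
  let Q : Finpartition u := glue hb (.indiscrete (ne_empty_of_mem hab)) ⊥
  have hQ : {b} ⊆ Q.parts := subset_union_left
  have hcount := card_filter_subset_parts_eq_card_kBlockPartitions (k := k + 1) hQ (by simp)
  rw [sup_singleton, id, card_singleton, Nat.add_sub_cancel] at hcount
  simpa only [hpart] using hcount

theorem card_kBlockPartitions (u : Finset α) (k : ℕ) :
    #(kBlockPartitions u k) = Nat.stirlingSecond #u k := by
  induction u using Finset.strongInduction generalizing k with
  | H u ih =>
  rcases u.eq_empty_or_nonempty with rfl | ⟨a, ha⟩
  · have hempty (P : Finpartition (∅ : Finset α)) : #P.parts = 0 :=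
      card_eq_zero.2 (P.parts_eq_empty_iff.2 rfl)
    cases k with
    | zero =>
      simp only [kBlockPartitions, hempty, filter_true, card_empty, Nat.stirlingSecond_zero]
      exact Fintype.card_unique (α := Finpartition (⊥ : Finset α))
    | succ k => simp [kBlockPartitions, hempty]
  have hcard : #(u.erase a) + 1 = #u := card_erase_add_one ha
  cases k with
  | zero =>
    rw [← hcard, Nat.stirlingSecond_succ_zero, card_eq_zero, eq_empty_iff_forall_notMem]
    intro P hP
    exact card_ne_zero_of_mem (P.part_mem.2 ha) (mem_kBlockPartitions.1 hP)
  | succ k =>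
    have hmaps : Set.MapsTo (fun P : Finpartition u => u \ P.part a) (kBlockPartitions u (k + 1))
        (u.erase a).powerset := fun P _ => by
      rw [mem_coe, mem_powerset, subset_erase]
      exact ⟨sdiff_subset, fun h => (mem_sdiff.1 h).2 (P.mem_part_self.2 ha)⟩
    rw [← hcard, ← sum_powerset_stirlingSecond_card, card_eq_sum_card_fiberwise hmaps]
    refine sum_congr rfl fun c hc => ?_
    obtain ⟨hcu, hac⟩ := subset_erase.1 (mem_powerset.1 hc)
    have hfiber (P : Finpartition u) : u \ P.part a = c ↔ P.part a = u \ c := by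
      constructor <;> rintro h
      · rw [← h, Finset.sdiff_sdiff_eq_self (P.part_subset a)]
      · rw [h, Finset.sdiff_sdiff_eq_self hcu]
    simp only [hfiber]
    rw [card_filter_part_eq sdiff_subset (mem_sdiff.2 ⟨ha, hac⟩), Finset.sdiff_sdiff_eq_self hcu]
    exact ih c ((ssubset_iff_of_subset hcu).2 ⟨a, ha, hac⟩) k

theorem card_filter_subset_parts {Q : Finpartition u} {Y : Finset (Finset α)} (hY : Y ⊆ Q.parts)
    (hk : #Y ≤ k) :
    #{P ∈ kBlockPartitions u k | Y ⊆ P.parts} =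
      Nat.stirlingSecond (#u - #(Y.sup id)) (k - #Y) := by
  have hsup : Y.sup id ⊆ u := Finset.sup_le fun b hb => Q.le (hY hb)
  rw [card_filter_subset_parts_eq_card_kBlockPartitions hY hk, card_kBlockPartitions,
    card_sdiff_of_subset hsup]

theorem card_le_card_sup_of_subset_parts {Q : Finpartition u} {Y : Finset (Finset α)}
    (hY : Y ⊆ Q.parts) : #Y ≤ #(Y.sup id) :=
  (Q.ofSubset hY rfl).card_parts_le_card

theorem card_filter_subset_parts_le (Y : Finset (Finset α)) (hk : #Y < k) :
    #{P ∈ kBlockPartitions u k | Y ⊆ P.parts} ≤ Nat.stirlingSecond (#u - #Y) (k - #Y) := by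
  rcases ({P ∈ kBlockPartitions u k | Y ⊆ P.parts}).eq_empty_or_nonempty with h | ⟨Q, hQ⟩
  · simp [h]
  have hY : Y ⊆ Q.parts := (mem_filter.1 hQ).2
  rw [card_filter_subset_parts hY hk.le]
  exact stirlingSecond_mono (by lia)
    (Nat.sub_le_sub_left (card_le_card_sup_of_subset_parts hY) _)

end CountingPartitions

section PartitionsWithSmallBlocks

open Finset

variable {α : Type*} [DecidableEq α] {s : Finset α}

theorem eq_bot_of_card_parts_eq_card {P : Finpartition s} (h : #P.parts = #s) : P = ⊥ := by
  have hsum : ∑ _b ∈ P.parts, 1 = ∑ b ∈ P.parts, #b := by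
    rw [P.sum_card_parts, ← h, card_eq_sum_ones]
  have hpos : ∀ b ∈ P.parts, 1 ≤ #b := fun b hb => (P.nonempty_of_mem_parts hb).card_pos
  have hone := (sum_eq_sum_iff_of_le hpos).1 hsum
  refine le_bot_iff.1 fun b hb => ?_
  obtain ⟨a, rfl⟩ := card_eq_one.1 (hone b hb).symm
  exact ⟨{a}, Finpartition.mem_bot_iff.2 ⟨a, P.le hb (mem_singleton_self a), rfl⟩, le_rfl⟩

theorem exists_pair_and_singletons_of_card_eq_card_parts_add_one {P : Finpartition s}
    (h : #s = #P.parts + 1) :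
    ∃ A B : Finset α, #A = #P.parts - 1 ∧ #B = 2 ∧ Disjoint A B ∧
      P.parts = insert B (A.image singleton) := by
  obtain ⟨B, hB, hB1⟩ : ∃ B ∈ P.parts, 1 < #B := by
    refine exists_lt_of_sum_lt ?_
    rw [P.sum_card_parts, ← card_eq_sum_ones]
    lia
  obtain ⟨R, hR⟩ : ∃ R : Finpartition (s \ B), R.parts = P.parts \ {B} :=
    ⟨(removeBlocks P (singleton_subset_iff.2 hB)).copy (by rw [sup_singleton, id]), rfl⟩
  have hRcard : #R.parts = #P.parts - 1 := by
    rw [hR, card_sdiff_of_subset (singleton_subset_iff.2 hB), card_singleton]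
  have hsB : #(s \ B) = #s - #B := card_sdiff_of_subset (P.le hB)
  have hRle : #R.parts ≤ #(s \ B) := R.card_parts_le_card
  have hpos : 0 < #P.parts := card_pos.2 ⟨B, hB⟩
  have hBs : #B ≤ #s := card_le_card (P.le hB)
  have hsingletons : P.parts.erase B = (s \ B).image singleton := by
    rw [← sdiff_singleton_eq_erase, ← hR, eq_bot_of_card_parts_eq_card (P := R) (by lia),
      Finpartition.parts_bot, map_eq_image]
    rfl
  refine ⟨s \ B, B, by lia, by lia, sdiff_disjoint, ?_⟩
  rw [← hsingletons, insert_erase hB]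

end PartitionsWithSmallBlocks

section IntersectingFamilies

open Finset

theorem two_mul_sub_le_of_pow_le_two_pow {n k t : ℕ} (hk : t < k)
    (hn : ((t + 1) * (k - t + 1)) ^ (2 * (k - t - 1)) ≤ 2 ^ (n - t - 1)) :
    2 * (k - t - 1) ≤ n - t - 1 := by
  refine two_mul_le_of_pow_le_two_pow ?_ hn
  calc 2 ≤ k - t + 1 := by lia
    _ ≤ (t + 1) * (k - t + 1) := Nat.le_mul_of_pos_left _ t.succ_pos

theorem pow_mul_stirlingSecond_lt {n k t s : ℕ}
    (hn : ((t + 1) * (k - t + 1)) ^ (2 * (k - t - 1)) ≤ 2 ^ (n - t - 1)) (hts : t < s)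
    (hsk : s < k) :
    (t + 1) ^ (s + 1 - t) * ((k + 1 - t) ^ (s - t) * Nat.stirlingSecond (n - s) (k - s)) <
      Nat.stirlingSecond (n - t - 1) (k - t) := by
  obtain ⟨j, rfl⟩ : ∃ j, s = t + 1 + j := Nat.exists_eq_add_of_le hts
  obtain ⟨r, rfl⟩ := Nat.exists_eq_add_of_le hsk.le
  have hjn := two_mul_sub_le_of_pow_le_two_pow (by lia) hn
  rw [show t + 1 + j + r - t + 1 = r + j + 2 by lia,
    show t + 1 + j + r - t - 1 = r + j by lia] at hn
  obtain ⟨m, hm⟩ : ∃ m, n - t - 1 = m + j := ⟨n - t - 1 - j, by lia⟩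
  rw [hm] at hn ⊢
  rw [show n - (t + 1 + j) = m by lia, show t + 1 + j + r - (t + 1 + j) = r by lia,
    show t + 1 + j + r - t = r + j + 1 by lia, show t + 1 + j + r + 1 - t = r + j + 2 by lia,
    show t + 1 + j + 1 - t = j + 2 by lia, show t + 1 + j - t = j + 1 by lia]
  calc (t + 1) ^ (j + 2) * ((r + j + 2) ^ (j + 1) * Nat.stirlingSecond m r)
      = (t + 1) ^ 2 * (r + j + 2) *
          (((t + 1) * (r + j + 2)) ^ j * Nat.stirlingSecond m r) := by
        rw [mul_pow _ _ j]
        ring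
    _ ≤ (t + 1) ^ 2 * (r + j + 2) * Nat.stirlingSecond (m + j) (r + j) := by
        gcongr
        exact pow_mul_stirlingSecond_le_add_add (by lia) (by nlinarith) hn
    _ < Nat.stirlingSecond (m + j) (r + j + 1) :=
        sq_mul_stirlingSecond_lt_succ_right (by lia) t.succ_ne_zero hn

variable {α : Type*} [DecidableEq α] {u : Finset α} {k t : ℕ} {F : Finset (Finpartition u)}

theorem card_lt_stirlingSecond_of_forall_isCover (hk : t + 2 ≤ k)
    (hn : ((t + 1) * (k - t + 1)) ^ (2 * (k - t - 1)) ≤ 2 ^ (#u - t - 1))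
    (hFk : F ⊆ kBlockPartitions u k) (hF : ∀ P ∈ F, IsCover t F Finpartition.parts P.parts)
    (hcover : ∀ T, IsCover t F Finpartition.parts T → t < #T) :
    #F < Nat.stirlingSecond (#u - t - 1) (k - t) := by
  obtain ⟨s, hts, hsk, hs⟩ := exists_card_le_pow_mul
    (fun P hP => (mem_kBlockPartitions.1 (hFk hP)).le) hF hk
    (c := fun s => Nat.stirlingSecond (#u - s) (k - s))
    (fun X hX => (card_le_card (filter_subset_filter _ hFk)).trans
      (card_filter_subset_parts_le X hX)) hcover
  exact hs.trans_lt (pow_mul_stirlingSecond_lt hn hts hsk)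

/-- Maximal `t`-intersecting families of partitions of a finite set `u` into `k` blocks. For
`u = univ` this is definitionally `IsMaximalIntersectingFamily`. -/
def IsMaximalIntersecting (k t : ℕ) (F : Finset (Finpartition u)) : Prop :=
  Maximal (fun G : Finset (Finpartition u) => G ⊆ kBlockPartitions u k ∧
    ∀ P ∈ G, ∀ Q ∈ G, t ≤ #(P.parts ∩ Q.parts)) F

theorem eq_filter_subset_parts_of_maximal (hF : IsMaximalIntersecting k t F)
    {Y : Finset (Finset α)} (hY : t ≤ #Y) (hYF : ∀ P ∈ F, Y ⊆ P.parts) :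
    F = {P ∈ kBlockPartitions u k | Y ⊆ P.parts} := by
  refine hF.eq_of_le ⟨filter_subset _ _, fun P hP Q hQ => hY.trans (card_le_card ?_)⟩ fun P hP =>
    mem_filter.2 ⟨hF.prop.1 hP, hYF P hP⟩
  exact subset_inter (mem_filter.1 hP).2 (mem_filter.1 hQ).2

theorem card_lt_stirlingSecond_or_eq_filter_subset_parts (hk : t + 2 ≤ k)
    (hn : ((t + 1) * (k - t + 1)) ^ (2 * (k - t - 1)) ≤ 2 ^ (#u - t - 1))
    (hF : IsMaximalIntersecting k t F) :
    #F < Nat.stirlingSecond (#u - t - 1) (k - t) ∨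
      ∃ Q ∈ F, ∃ Y ⊆ Q.parts, #Y = t ∧ F = {P ∈ kBlockPartitions u k | Y ⊆ P.parts} := by
  rcases F.eq_empty_or_nonempty with rfl | ⟨Q, hQ⟩
  · have h2 : 2 * (k - t - 1) ≤ #u - t - 1 := two_mul_sub_le_of_pow_le_two_pow (by lia) hn
    exact .inl (stirlingSecond_pos (by lia) (by lia))
  refine or_iff_not_imp_left.2 fun hlarge => ?_
  obtain ⟨Y, hYcover, hYcard⟩ : ∃ Y, IsCover t F Finpartition.parts Y ∧ #Y ≤ t := by
    by_contra! hcover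
    exact hlarge (card_lt_stirlingSecond_of_forall_isCover hk hn hF.prop.1 hF.prop.2 hcover)
  have hY (P) (hP : P ∈ F) := hYcover.subset_and_card_eq_of_card_le hYcard hP
  exact ⟨Q, hQ, Y, (hY Q hQ).1, (hY Q hQ).2,
    eq_filter_subset_parts_of_maximal hF (hY Q hQ).2.ge fun P hP => (hY P hP).1⟩

theorem exists_pair_and_singletons_of_card_sup_eq {Q : Finpartition u} {Y : Finset (Finset α)}
    (hY : Y ⊆ Q.parts) (h : #(Y.sup id) = #Y + 1) :
    ∃ A B : Finset α, #A = #Y - 1 ∧ #B = 2 ∧ Disjoint A B ∧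
      ∀ P : Finpartition u, Y ⊆ P.parts ↔ (∀ a ∈ A, {a} ∈ P.parts) ∧ B ∈ P.parts := by
  obtain ⟨A, B, hA, hB, hAB, hYAB⟩ :=
    exists_pair_and_singletons_of_card_eq_card_parts_add_one (P := Q.ofSubset hY rfl) h
  refine ⟨A, B, hA, hB, hAB, fun P => ?_⟩
  rw [show Y = insert B (A.image singleton) from hYAB, insert_subset_iff, image_subset_iff,
    and_comm]

end IntersectingFamilies

theorem pow_le_two_pow_of_two_mul_L_le {n k t : ℕ} (hk : t ≤ k) (hn : 2 * L k t ≤ n) :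
    ((t + 1) * (k - t + 1)) ^ (2 * (k - t - 1)) ≤ 2 ^ (n - t - 1) := by
  obtain ⟨d, rfl⟩ := Nat.exists_eq_add_of_le hk
  rw [Nat.add_sub_cancel_left]
  have hX : 1 ≤ (t + 1) * (d + 1) := Nat.mul_pos t.succ_pos d.succ_pos
  have hlog : 0 ≤ Real.logb 2 ((t + 1) * (d + 1) : ℕ) :=
    Real.logb_nonneg one_lt_two (by exact_mod_cast hX)
  have hL : 2 * (t + 1 : ℝ) + 2 * (d + 1) * Real.logb 2 ((t + 1) * (d + 1) : ℕ) ≤ n := by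
    have hd : ((t + d : ℕ) : ℝ) - t = d := by push_cast; ring
    rw [L, hd] at hn
    push_cast
    linarith
  have htn : t + 1 ≤ n := by
    have : (t + 1 : ℝ) ≤ n := by nlinarith
    exact_mod_cast this
  have hexp : ((2 * (d - 1) : ℕ) : ℝ) ≤ 2 * (d + 1) := by
    exact_mod_cast (by lia : 2 * (d - 1) ≤ 2 * (d + 1))
  have hbound : (2 * (d - 1) : ℕ) * Real.logb 2 ((t + 1) * (d + 1) : ℕ) ≤ (n - t - 1 : ℕ) := by
    rw [Nat.sub_sub, Nat.cast_sub htn, Nat.cast_add_one]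
    linarith [mul_le_mul_of_nonneg_right hexp hlog]
  rw [← Real.logb_pow, Real.logb_le_iff_le_rpow one_lt_two (by positivity), Real.rpow_natCast]
    at hbound
  exact_mod_cast hbound

end PartitionFamilies

open Finset PartitionFamilies in
theorem mainTheorem4_general {α : Type*} [DecidableEq α] {u : Finset α} {n k t : ℕ} (hu : #u = n)
    (hk : t + 2 ≤ k) (hn : ((t + 1) * (k - t + 1)) ^ (2 * (k - t - 1)) ≤ 2 ^ (n - t - 1))
    {F : Finset (Finpartition u)} (hF : IsMaximalIntersecting k t F)
    (hcard : #F < Nat.stirlingSecond (n - t) (k - t)) :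
    #F ≤ Nat.stirlingSecond (n - t - 1) (k - t) ∧
      (#F = Nat.stirlingSecond (n - t - 1) (k - t) →
        ∃ A B : Finset α, #A = t - 1 ∧ #B = 2 ∧ Disjoint A B ∧
          F = {P ∈ kBlockPartitions u k | (∀ a ∈ A, {a} ∈ P.parts) ∧ B ∈ P.parts}) := by
  subst hu
  have h2 : 2 * (k - t - 1) ≤ #u - t - 1 := two_mul_sub_le_of_pow_le_two_pow (by lia) hn
  rcases card_lt_stirlingSecond_or_eq_filter_subset_parts hk hn hF with
    hsmall | ⟨Q, -, Y, hY, rfl, hFY⟩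
  · exact ⟨hsmall.le, fun h => absurd h hsmall.ne⟩
  have hFcard : #F = Nat.stirlingSecond (#u - #(Y.sup id)) (k - #Y) := by
    rw [hFY, card_filter_subset_parts hY (by lia)]
  have hsup : #Y + 1 ≤ #(Y.sup id) :=
    (card_le_card_sup_of_subset_parts hY).lt_of_ne fun h => by
      rw [hFcard, ← h] at hcard
      exact hcard.false
  refine ⟨hFcard.trans_le (stirlingSecond_mono (by lia) (by lia)), fun h => ?_⟩
  have hpair : #(Y.sup id) = #Y + 1 := by
    by_contra hne
    have := stirlingSecond_lt_stirlingSecond (a := #u - #(Y.sup id)) (b := #u - #Y - 1)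
      (r := k - #Y) (by lia) (by lia) (by lia)
    lia
  obtain ⟨A, B, hA, hB, hAB, hiff⟩ := exists_pair_and_singletons_of_card_sup_eq hY hpair
  exact ⟨A, B, hA, hB, hAB, hFY.trans (filter_congr fun P _ => hiff P)⟩

theorem mainTheorem4 (n k t : ℕ) (ht : 1 ≤ t) (hk : t + 3 ≤ k)
    (hn : 2 * PartitionFamilies.L k t ≤ (n : ℝ))
    (F : Finset (PartitionFamilies.SetPartition n))
    (hF : PartitionFamilies.IsMaximalIntersectingFamily k t F)
    (hcard : F.card < Nat.stirlingSecond (n - t) (k - t)) :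
    F.card ≤ Nat.stirlingSecond (n - t - 1) (k - t) ∧
      (F.card = Nat.stirlingSecond (n - t - 1) (k - t) →
        ∃ A B : Finset (Fin n), A.card = t - 1 ∧ B.card = 2 ∧ Disjoint A B ∧
          F = (PartitionFamilies.kPartitions n k).filter
            (fun P => (∀ a ∈ A, {a} ∈ P.parts) ∧ B ∈ P.parts)) := by
  convert mainTheorem4_general (Finset.card_fin n) (by lia)
    (PartitionFamilies.pow_le_two_pow_of_two_mul_L_le (by lia) hn) hF hcard
  rfl
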